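/- Let $G$ be a finite simple graph. An incidence of $G$ is a pair $(v,e)$ where $v$ is a vertex and $e$ is an edge of $G$ incident with $v$. Two distinct incidences $(v,e)$ and $(w,f)$ are adjacent if $v=w$, or $e=f$, or the edge $vw$ equals $e$ or $f$. An incidence $k$-coloring of $G$ is a map from the set of incidences of $G$ to a set of $k$ colors that assigns distinct colors to adjacent incidences, and the incidence chromatic number $\chi_i(G)$ is the smallest $k$ such that $G$ admits an incidence $k$-coloring. For $m,n\ge 3$ let $T_{m,n}=C_m\,\Box\,C_n$ be the toroidal grid, the Cartesian product of the cycles on $m$ and on $n$ vertices. **Theorem.** For all $m,n\ge 3$, $\chi_i(T_{m,n})=5$ if $m\equiv 0\pmod 5$ and $n\equiv 0\pmod 5$, and $\chi_i(T_{m,n})=6$ otherwise. -/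

import Mathlib

namespace SimpleGraph

/-- An incidence of `G`: a pair `(v, e)` of a vertex `v` and an edge `e` of `G` incident to `v`. -/
def Incidence {V : Type*} (G : SimpleGraph V) : Type _ :=
  {p : V × Sym2 V // p.2 ∈ G.edgeSet ∧ p.1 ∈ p.2}

/-- Adjacency of incidences: two distinct incidences `(v, e)` and `(w, f)` are adjacent if
`v = w`, or `e = f`, or the edge `vw` is `e` or `f`. -/
def incidenceGraph {V : Type*} (G : SimpleGraph V) : SimpleGraph G.Incidence where
  Adj i j := i ≠ j ∧
    (i.1.1 = j.1.1 ∨ i.1.2 = j.1.2 ∨ s(i.1.1, j.1.1) = i.1.2 ∨ s(i.1.1, j.1.1) = j.1.2)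
  symm := ⟨by
    rintro i j ⟨hne, h⟩
    refine ⟨hne.symm, ?_⟩
    rw [Sym2.eq_swap]
    rcases h with h | h | h | h
    · exact Or.inl h.symm
    · exact Or.inr (Or.inl h.symm)
    · exact Or.inr (Or.inr (Or.inr h))
    · exact Or.inr (Or.inr (Or.inl h))⟩
  loopless := ⟨fun _ h => h.1 rfl⟩

/-- The incidence chromatic number of `G`: the least `k` for which there is a map from the
incidences of `G` to a set of `k` colors giving distinct colors to adjacent incidences
(`⊤` if there is no such `k`). -/
noncomputable def incidenceChromaticNumber {V : Type*} (G : SimpleGraph V) : ℕ∞ :=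
  G.incidenceGraph.chromaticNumber

/-- The toroidal grid `C_m □ C_n`. -/
abbrev toroidalGrid (m n : ℕ) : SimpleGraph (Fin m × Fin n) :=
  cycleGraph m □ cycleGraph n

end SimpleGraph

/-! An incidence `(v, vw)` is the dart from `v` to `w`, so one colors the four darts leaving each
vertex. A dart entering a vertex avoids the four colors leaving it, so at least five colors are
needed. With exactly five, each vertex `v` has a single missing color `c v`, which all darts
entering `v` must carry; hence `c` is rainbow on closed neighborhoods. This forces `c` to have
period 5 in both directions (`rainbow_add_five`), hence `5 ∣ m` and `5 ∣ n`. Conversely, `a + 2b`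
mod 5 gives such a `c`. Six colors always suffice: a finite pattern over pairs of vertices of a
digraph with closed walks of every length at least 3 pulls back to the torus. -/

namespace SimpleGraph

/-! ### Incidences as darts. -/

section Darts

variable {V : Type*} {G : SimpleGraph V}

/-- A dart coloring is proper if darts leaving the same vertex have different colors, and a dart
entering a vertex has a color different from those of all darts leaving it. -/
structure IsProperDartColoring {α : Type*} (f : G.Dart → α) : Prop where
  fst_ne : ∀ d d' : G.Dart, d ≠ d' → d.fst = d'.fst → f d ≠ f d'
  snd_ne : ∀ d d' : G.Dart, d.snd = d'.fst → f d ≠ f d'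

theorem incidenceGraph_colorable_iff {k : ℕ} :
    G.incidenceGraph.Colorable k ↔ ∃ f : G.Dart → Fin k, IsProperDartColoring f := by
  constructor
  · rintro ⟨C⟩
    refine ⟨fun d => C ⟨(d.fst, d.edge), d.edge_mem, Sym2.mem_mk_left _ _⟩, ?_, ?_⟩
    · intro d d' hne h
      refine C.valid ⟨fun heq => hne ?_, Or.inl h⟩
      have hedge : d.edge = d'.edge := congrArg (fun i => i.1.2) heq
      have hs : d.snd = d'.snd := by
        change s(d.fst, d.snd) = s(d'.fst, d'.snd) at hedge
        rw [h] at hedge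
        exact Sym2.congr_right.1 hedge
      exact Dart.ext _ _ (Prod.ext h hs)
    · intro d d' h
      refine C.valid ⟨fun heq => d.adj.ne ?_, Or.inr (Or.inr (Or.inl ?_))⟩
      · exact (congrArg (fun i => i.1.1) heq : d.fst = d'.fst).trans h.symm
      · change s(d.fst, d'.fst) = s(d.fst, d.snd)
        rw [h]
  · rintro ⟨f, hf⟩
    have hex : ∀ i : G.Incidence, ∃ d : G.Dart, d.fst = i.1.1 ∧ s(d.fst, d.snd) = i.1.2 := by
      rintro ⟨⟨v, e⟩, he, hv⟩
      obtain ⟨w, hw⟩ := hv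
      change e = s(v, w) at hw
      subst hw
      exact ⟨⟨(v, w), he⟩, rfl, rfl⟩
    choose D hfst hedge using hex
    refine ⟨Coloring.mk (fun i => f (D i)) ?_⟩
    rintro i j ⟨hne, h⟩
    rw [← hfst i, ← hfst j, ← hedge i, ← hedge j] at h
    have hD : D i ≠ D j := fun heq => hne <| Subtype.ext <| Prod.ext
      (by rw [← hfst i, heq, hfst j]) (by rw [← hedge i, heq, hedge j])
    rcases h with h | h | h | h
    · exact hf.fst_ne _ _ hD h
    · rcases Sym2.eq_iff.1 h with ⟨h, -⟩ | ⟨-, h⟩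
      · exact hf.fst_ne _ _ hD h
      · exact hf.snd_ne _ _ h
    · exact hf.snd_ne _ _ (Sym2.congr_right.1 h).symm
    · rw [Sym2.eq_swap] at h
      exact (hf.snd_ne _ _ (Sym2.congr_right.1 h).symm).symm

end Darts

/-! ### Rigidity of rainbow colorings with five colors. -/

section Period

/-- The five cells of a closed neighborhood in the grid spanned by `a` and `b` have distinct
colors. -/
def IsRainbowAt {A α : Type*} [AddCommGroup A] (a b : A) (c : A → α) (v : A) : Prop :=
  [c v, c (v + a), c (v + b), c (v - a), c (v - b)].Nodup

variable {A : Type*} [AddCommGroup A] {a b : A} {c : A → Fin 5}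

theorem eq_or_of_nodup {p q r s t : Fin 5} (h : [p, q, r, s, t].Nodup) (x : Fin 5) :
    x = p ∨ x = q ∨ x = r ∨ x = s ∨ x = t := by
  have huniv : ([p, q, r, s, t].toFinset : Finset (Fin 5)) = Finset.univ := by
    apply Finset.eq_univ_of_card
    rw [List.toFinset_card_of_nodup h]
    rfl
  have hx := Finset.mem_univ x
  rw [← huniv] at hx
  simpa using hx

/-- The colors around `v` force those of the four diagonal cells up to a mirror image. In both cases
`v + 2a` and `v - 2a` get the colors of `v + b` and `v - b`, in some order. -/
theorem rainbow_ne_add_three (h : ∀ v, IsRainbowAt a b c v) (v : A) :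
    c (v + a + a) ≠ c (v - a) ∧ c (v + a + a) ≠ c (v - a - a) := by
  have h0 := h v
  have hE := h (v + a)
  have hN := h (v + b)
  have hW := h (v - a)
  have hS := h (v - b)
  have cover := eq_or_of_nodup h0
  have c1 := cover (c (v + a + b))
  have c2 := cover (c (v + a - b))
  have c3 := cover (c (v - a + b))
  have c4 := cover (c (v - a - b))
  have c5 := cover (c (v + a + a))
  have e1 : v + b + a = v + a + b := by abel
  have e2 : v + b - a = v - a + b := by abel
  have e3 : v - b + a = v + a - b := by abel
  have e4 : v - b - a = v - a - b := by abel
  simp only [IsRainbowAt, List.nodup_cons, List.mem_cons, List.not_mem_nil, not_or,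
    add_sub_cancel_right, sub_add_cancel, e1, e2, e3, e4] at h0 hE hN hW hS
  grind

theorem rainbow_add_five (h : ∀ v, IsRainbowAt a b c v) (v : A) :
    c (v + 5 • a) = c v := by
  have h1 : ∀ v, c v ≠ c (v + a) := fun v => by
    have := h v
    simp only [IsRainbowAt, List.nodup_cons, List.mem_cons, not_or] at this
    exact this.1.1
  have h2 : ∀ v, c v ≠ c (v + a + a) := fun v => by
    have := h (v + a)
    simp only [IsRainbowAt, List.nodup_cons, List.mem_cons, not_or, add_sub_cancel_right] at this
    exact fun heq => this.2.1.2.1 heq.symm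
  have h3 : ∀ v, c v ≠ c (v + a + a + a) := fun v => by
    have := (rainbow_ne_add_three h (v + a)).1
    rw [add_sub_cancel_right] at this
    exact this.symm
  have h4 : ∀ v, c v ≠ c (v + a + a + a + a) := fun v => by
    have := (rainbow_ne_add_three h (v + a + a)).2
    rw [add_sub_cancel_right, add_sub_cancel_right] at this
    exact this.symm
  have hnodup : [c v, c (v + a), c (v + a + a), c (v + a + a + a), c (v + a + a + a + a)].Nodup := by
    simp [h1, h2, h3, h4]
  have e : v + 5 • a = v + a + a + a + a + a := by
    rw [show (5 : ℕ) • a = a + a + a + a + a by abel]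
    abel
  rw [e]
  -- Five consecutive cells use all colors, and the sixth differs from the last four.
  rcases eq_or_of_nodup hnodup (c (v + a + a + a + a + a)) with h | h | h | h | h
  · exact h
  · exact absurd h.symm (h4 _)
  · exact absurd h.symm (h3 _)
  · exact absurd h.symm (h2 _)
  · exact absurd h.symm (h1 _)

/-- If 5 is invertible mod `m`, then `a` is a multiple of `5 • a`, so `c a = c 0`, although 0 and
`a` are neighbors. -/
theorem five_dvd_of_rainbow (h : ∀ v, IsRainbowAt a b c v) {m : ℕ} (hm : m • a = 0) : 5 ∣ m := by
  by_contra h5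
  have hcop : Nat.Coprime 5 m := (Nat.Prime.coprime_iff_not_dvd (by norm_num)).2 h5
  have hmul : ∀ k : ℕ, c (k • 5 • a) = c 0 := by
    intro k
    induction k with
    | zero => simp
    | succ k ih => rw [succ_nsmul, rainbow_add_five h, ih]
  have ha : ∃ k : ℕ, k • 5 • a = a := by
    obtain ⟨k, -, hk⟩ := Nat.exists_mul_mod_eq_one_of_coprime hcop (by
      rcases m with _ | _ | m
      · simp at hcop
      · have : a = 0 := by simpa using hm
        have h0 := h 0
        simp [IsRainbowAt, this] at h0
      · omega)
    refine ⟨k, ?_⟩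
    rw [smul_smul, mul_comm, ← Nat.div_add_mod (5 * k) m, hk, add_nsmul, mul_comm, mul_nsmul', hm]
    simp
  obtain ⟨k, hk⟩ := ha
  have := hmul k
  rw [hk] at this
  have h0 := h 0
  simp [IsRainbowAt, this] at h0

end Period

/-! ### Steps of the toroidal grid. -/

section Torus

variable {m n : ℕ}

theorem cycleGraph_adj_iff_add_sub [NeZero m] (hm : 2 ≤ m) (u v : Fin m) :
    (cycleGraph m).Adj u v ↔ v = u + 1 ∨ v = u - 1 := by
  obtain ⟨m, rfl⟩ : ∃ k, m = k + 2 := ⟨m - 2, by omega⟩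
  rw [cycleGraph_adj, sub_eq_iff_eq_add, sub_eq_iff_eq_add, eq_sub_iff_add_eq, add_comm 1 u,
    add_comm 1 v, eq_comm (a := u), or_comm]

/-- The four unit steps of the toroidal grid. -/
def unitStep (m n : ℕ) [NeZero m] [NeZero n] : Fin 4 → Fin m × Fin n :=
  ![(1, 0), (0, 1), (-1, 0), (0, -1)]

theorem toroidalGrid_adj_iff [NeZero m] [NeZero n] (hm : 2 ≤ m) (hn : 2 ≤ n)
    (u v : Fin m × Fin n) :
    (toroidalGrid m n).Adj u v ↔ ∃ k, v = u + unitStep m n k := by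
  rw [boxProd_adj, cycleGraph_adj_iff_add_sub hm, cycleGraph_adj_iff_add_sub hn]
  simp only [Fin.exists_fin_succ, unitStep, Prod.ext_iff, sub_eq_add_neg]
  simp [eq_comm]
  tauto

theorem unitStep_injective [NeZero m] [NeZero n] (hm : 3 ≤ m) (hn : 3 ≤ n) :
    Function.Injective (unitStep m n) := by
  have key : ∀ {k : ℕ} [NeZero k], 3 ≤ k → (1 : Fin k) ≠ 0 ∧ (1 : Fin k) ≠ -1 := by
    intro k _ hk
    obtain ⟨k, rfl⟩ : ∃ l, k = l + 3 := ⟨k - 3, by omega⟩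
    refine ⟨by simp, fun h => ?_⟩
    have h2 : (1 : Fin (k + 3)) + 1 = 0 := by rw [eq_neg_iff_add_eq_zero] at h; exact h
    have := congrArg Fin.val h2
    simp only [Fin.val_add, Fin.val_one, Fin.val_zero] at this
    rw [Nat.mod_eq_of_lt (by omega)] at this
    omega
  obtain ⟨h1, h2⟩ := key hm
  obtain ⟨h3, h4⟩ := key hn
  intro i j
  fin_cases i <;> fin_cases j <;> simp [unitStep, h1, h2, h3, h4, eq_comm]

end Torus

/-! ### Lower bounds on the torus. -/

section TorusColoring

variable {m n : ℕ} [NeZero m] [NeZero n]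

/-- An incidence coloring of the toroidal grid amounts to a choice, at every vertex, of colors for
the four outgoing darts. -/
theorem toroidalGrid_colorable_iff (hm : 3 ≤ m) (hn : 3 ≤ n) {k : ℕ} :
    (toroidalGrid m n).incidenceGraph.Colorable k ↔
      ∃ g : Fin m × Fin n → Fin 4 → Fin k,
        (∀ v, Function.Injective (g v)) ∧ ∀ v i j, g v i ≠ g (v + unitStep m n i) j := by
  have hadj := toroidalGrid_adj_iff (m := m) (n := n) (by omega) (by omega)
  rw [incidenceGraph_colorable_iff]
  constructor
  · rintro ⟨f, hf⟩
    refine ⟨fun v i => f ⟨(v, v + unitStep m n i), (hadj _ _).2 ⟨i, rfl⟩⟩, ?_, ?_⟩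
    · intro v i j hij
      by_contra hne
      refine hf.fst_ne ⟨(v, v + unitStep m n i), (hadj _ _).2 ⟨i, rfl⟩⟩
        ⟨(v, v + unitStep m n j), (hadj _ _).2 ⟨j, rfl⟩⟩ (fun heq => hne ?_) rfl hij
      have hs : v + unitStep m n i = v + unitStep m n j := congrArg (fun d => d.snd) heq
      exact unitStep_injective hm hn (add_left_cancel hs)
    · intro v i j
      exact hf.snd_ne _ _ rfl
  · rintro ⟨g, hinj, hg⟩
    have hex : ∀ d : (toroidalGrid m n).Dart, ∃ i, d.snd = d.fst + unitStep m n i :=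
      fun d => (hadj _ _).1 d.adj
    choose dir hdir using hex
    refine ⟨fun d => g d.fst (dir d), ?_, ?_⟩
    · intro d d' hne h heq
      rw [h] at heq
      have hi := hinj _ heq
      refine hne (Dart.ext _ _ (Prod.ext h ?_))
      rw [hdir d, hdir d', h, hi]
    · intro d d' h
      rw [← h, hdir d]
      exact hg _ _ _

theorem toroidalGrid_not_colorable_four (hm : 3 ≤ m) (hn : 3 ≤ n) :
    ¬ (toroidalGrid m n).incidenceGraph.Colorable 4 := by
  rw [toroidalGrid_colorable_iff hm hn]
  rintro ⟨g, hinj, hg⟩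
  obtain ⟨j, hj⟩ := Finite.surjective_of_injective (hinj (0 + unitStep m n 0)) (g 0 0)
  exact hg 0 0 j hj.symm

theorem exists_rainbow_of_colorable_five (hm : 3 ≤ m) (hn : 3 ≤ n)
    (h : (toroidalGrid m n).incidenceGraph.Colorable 5) :
    ∃ c : Fin m × Fin n → Fin 5, ∀ v, IsRainbowAt (1, 0) (0, 1) c v := by
  obtain ⟨g, hinj, hg⟩ := (toroidalGrid_colorable_iff hm hn).1 h
  have hex : ∀ v, ∃ x, ∀ i, x ≠ g v i := by
    intro v
    by_contra! hsurj
    have := Fintype.card_le_of_surjective (g v) fun x => (hsurj x).imp fun _ => Eq.symm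
    simp at this
  choose c hc using hex
  have hne : ∀ v {i j}, i ≠ j → g v i ≠ g v j := fun v _ _ hij heq => hij (hinj v heq)
  -- The color of an entering dart is none of the four leaving colors, so it is the missing one.
  have hout : ∀ v i, g v i = c (v + unitStep m n i) := by
    intro v i
    have hnodup : [c (v + unitStep m n i), g (v + unitStep m n i) 0, g (v + unitStep m n i) 1,
        g (v + unitStep m n i) 2, g (v + unitStep m n i) 3].Nodup := by
      simp [hc, hne]
    have := hg v i
    rcases eq_or_of_nodup hnodup (g v i) with h | h | h | h | h
    · exact h
    all_goals exact absurd h (this _)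
  refine ⟨c, fun v => ?_⟩
  have h0 := hout v 0
  have h1 := hout v 1
  have h2 := hout v 2
  have h3 := hout v 3
  have e2 : v + unitStep m n 2 = v - (1, 0) := by
    simp [unitStep, sub_eq_add_neg]
  have e3 : v + unitStep m n 3 = v - (0, 1) := by
    simp [unitStep, sub_eq_add_neg]
  rw [e2] at h2
  rw [e3] at h3
  change g v 0 = c (v + (1, 0)) at h0
  change g v 1 = c (v + (0, 1)) at h1
  rw [IsRainbowAt, ← h0, ← h1, ← h2, ← h3]
  simp [hc, hne]

theorem five_dvd_of_colorable_five (hm : 3 ≤ m) (hn : 3 ≤ n)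
    (h : (toroidalGrid m n).incidenceGraph.Colorable 5) : 5 ∣ m ∧ 5 ∣ n := by
  obtain ⟨c, hc⟩ := exists_rainbow_of_colorable_five hm hn h
  have hc' : ∀ v, IsRainbowAt (0, 1) (1, 0) c v := fun v => by
    have := hc v
    unfold IsRainbowAt at this ⊢
    refine (List.Perm.nodup_iff ?_).1 this
    exact ((List.Perm.swap _ _ _).trans (((List.Perm.swap _ _ _).cons _).cons _)).cons _
  have hcard : ∀ (k : ℕ) [NeZero k], k • (1 : Fin k) = 0 := fun k _ => by
    simpa using card_nsmul_eq_zero (x := (1 : Fin k))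
  constructor
  · exact five_dvd_of_rainbow hc (Prod.ext (hcard m) (smul_zero m))
  · exact five_dvd_of_rainbow hc' (Prod.ext (smul_zero n) (hcard n))

/-! ### Colorings pulled back from finite patterns. -/

/-- A coloring of the outgoing darts over a product of two relations pulls back along cyclic walks
to a coloring of the toroidal grid. -/
theorem toroidalGrid_colorable_of_pattern (hm : 3 ≤ m) (hn : 3 ≤ n) {A B : Type*} {k : ℕ}
    {R : A → A → Prop} {S : B → B → Prop} (F : A → B → Fin 4 → Fin k)
    (hinj : ∀ a b i j, F a b i = F a b j → i = j)
    (hR : ∀ a a', R a a' → ∀ b j, F a b 0 ≠ F a' b j ∧ F a' b 2 ≠ F a b j)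
    (hS : ∀ b b', S b b' → ∀ a j, F a b 1 ≠ F a b' j ∧ F a b' 3 ≠ F a b j)
    {x : Fin m → A} (hx : ∀ i, R (x i) (x (i + 1)))
    {y : Fin n → B} (hy : ∀ i, S (y i) (y (i + 1))) :
    (toroidalGrid m n).incidenceGraph.Colorable k := by
  refine (toroidalGrid_colorable_iff hm hn).2
    ⟨fun v => F (x v.1) (y v.2), fun v i j => hinj _ _ i j, ?_⟩
  rintro ⟨p, q⟩ i j
  fin_cases i
  · simpa [unitStep] using (hR _ _ (hx p) (y q) j).1
  · simpa [unitStep] using (hS _ _ (hy q) (x p) j).1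
  · have := (hR _ _ (hx (p - 1)) (y q) j).2
    rw [sub_add_cancel] at this
    simpa [unitStep, sub_eq_add_neg] using this
  · have := (hS _ _ (hy (q - 1)) (x p) j).2
    rw [sub_add_cancel] at this
    simpa [unitStep, sub_eq_add_neg] using this

theorem exists_cyclic_walk {A : Type*} {R : A → A → Prop} {w : ℕ → A}
    (hw : ∀ i < m, R (w i) (w (i + 1))) (hclosed : w m = w 0) :
    ∃ x : Fin m → A, ∀ i, R (x i) (x (i + 1)) := by
  refine ⟨fun i => w i, fun i => ?_⟩
  have hstep := hw i i.2
  convert hstep using 1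
  change w (i + 1 : Fin m).val = w (i + 1)
  rw [Fin.val_add, Fin.val_one', Nat.add_mod_mod]
  rcases (Nat.succ_le_of_lt i.2).lt_or_eq with h | h
  · rw [Nat.mod_eq_of_lt h]
  · change (i : ℕ) + 1 = m at h
    rw [h, Nat.mod_self, hclosed]

theorem toroidalGrid_colorable_five (hm : 3 ≤ m) (hn : 3 ≤ n) (h5m : 5 ∣ m) (h5n : 5 ∣ n) :
    (toroidalGrid m n).incidenceGraph.Colorable 5 := by
  have hwalk : ∀ k : ℕ, ∀ [NeZero k], 5 ∣ k →
      ∃ x : Fin k → Fin 5, ∀ i, x (i + 1) = x i + 1 := by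
    intro k _ hk
    refine exists_cyclic_walk (R := fun a b : Fin 5 => b = a + 1) (w := fun i => Fin.ofNat 5 i)
      (fun i _ => ?_) ?_
    · ext
      simp [Fin.val_add]
    · ext
      simp [Nat.mod_eq_zero_of_dvd hk]
  obtain ⟨x, hx⟩ := hwalk m h5m
  obtain ⟨y, hy⟩ := hwalk n h5n
  exact toroidalGrid_colorable_of_pattern hm hn (R := fun a b : Fin 5 => b = a + 1)
    (S := fun a b : Fin 5 => b = a + 1)
    -- Each dart gets the value of `a + 2b` at its head.
    (fun a b => ![a + 2 * b + 1, a + 2 * b + 2, a + 2 * b - 1, a + 2 * b - 2])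
    (by decide) (by decide) (by decide) hx hy

/-- The arcs of three directed cycles, of lengths three, four and five, sharing the arc from `0` to
`1`. -/
def IsGluedCycleArc (a b : Fin 7) : Prop :=
  (a, b) ∈ [(0, 1), (1, 2), (2, 0), (1, 3), (3, 4), (4, 0), (3, 5), (5, 6), (6, 0)]

instance : DecidableRel IsGluedCycleArc := fun _ _ => inferInstanceAs (Decidable (_ ∈ _))

/-- Every length is 3, 4 or 5 plus a multiple of 3, and laps of the 3-cycle can be prepended at the
common vertex `0`. -/
theorem exists_gluedCycle_walk (k : ℕ) (hk : 3 ≤ k) :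
    ∃ w : ℕ → Fin 7, (∀ i < k, IsGluedCycleArc (w i) (w (i + 1))) ∧ w 0 = 0 ∧ w k = 0 := by
  induction k using Nat.strong_induction_on with
  | _ k ih =>
    by_cases h3 : k = 3
    · subst h3
      -- The default value of `getD` supplies the final vertex `0` at index `k`.
      exact ⟨fun i => [0, 1, 2].getD i 0, by decide, rfl, rfl⟩
    by_cases h4 : k = 4
    · subst h4
      exact ⟨fun i => [0, 1, 3, 4].getD i 0, by decide, rfl, rfl⟩
    by_cases h5 : k = 5
    · subst h5
      exact ⟨fun i => [0, 1, 3, 5, 6].getD i 0, by decide, rfl, rfl⟩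
    obtain ⟨w, hw, h0, hlast⟩ := ih (k - 3) (by omega) (by omega)
    refine ⟨fun i => if i < 3 then [0, 1, 2].getD i 0 else w (i - 3), fun i hi => ?_, rfl, ?_⟩
    · match i with
      | 0 => exact (by decide : IsGluedCycleArc 0 1)
      | 1 => exact (by decide : IsGluedCycleArc 1 2)
      | 2 =>
        simp only [Nat.reduceLT, Nat.reduceAdd, if_true, if_false, Nat.reduceSub, h0]
        decide
      | i + 3 =>
        have := hw i (by omega)
        have e : i + 3 + 1 - 3 = i + 1 := by omega
        simpa [show ¬ i + 3 < 3 by omega, show ¬ i + 3 + 1 < 3 by omega, e] using this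
    · simpa [show ¬ k < 3 by omega] using hlast

/-- Colors of the four outgoing darts for a six-coloring over the square of `IsGluedCycleArc`. -/
def sixColorPattern : Fin 7 → Fin 7 → Fin 4 → Fin 6 :=
  ![![![0, 1, 2, 3], ![0, 3, 4, 5], ![4, 5, 0, 2], ![5, 4, 0, 1],
      ![1, 5, 0, 2], ![0, 5, 2, 3], ![2, 4, 0, 1]],
    ![![1, 2, 5, 4], ![4, 5, 1, 3], ![0, 3, 1, 2], ![0, 4, 3, 2],
      ![2, 0, 3, 5], ![3, 2, 1, 5], ![1, 3, 5, 0]],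
    ![![5, 4, 3, 0], ![1, 5, 0, 2], ![1, 2, 4, 3], ![3, 2, 1, 4],
      ![3, 1, 4, 5], ![1, 0, 4, 5], ![5, 2, 4, 3]],
    ![![2, 4, 0, 5], ![5, 0, 2, 1], ![2, 1, 4, 3], ![3, 2, 5, 4],
      ![0, 3, 4, 1], ![5, 1, 4, 0], ![0, 3, 4, 2]],
    ![![4, 5, 3, 0], ![1, 0, 3, 2], ![3, 1, 5, 4], ![2, 5, 1, 4],
      ![4, 1, 2, 3], ![1, 4, 3, 0], ![3, 1, 5, 2]],
    ![![5, 0, 3, 4], ![3, 2, 4, 1], ![3, 1, 5, 0], ![5, 4, 1, 0],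
      ![1, 2, 5, 3], ![1, 0, 3, 2], ![3, 2, 1, 5]],
    ![![4, 3, 1, 0], ![1, 0, 5, 2], ![1, 5, 2, 4], ![3, 1, 2, 4],
      ![3, 2, 4, 5], ![4, 3, 5, 0], ![5, 2, 4, 1]]]

theorem toroidalGrid_colorable_six (hm : 3 ≤ m) (hn : 3 ≤ n) :
    (toroidalGrid m n).incidenceGraph.Colorable 6 := by
  have hwalk : ∀ k : ℕ, ∀ [NeZero k], 3 ≤ k →
      ∃ x : Fin k → Fin 7, ∀ i, IsGluedCycleArc (x i) (x (i + 1)) := by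
    intro k _ hk
    obtain ⟨w, hw, h0, hlast⟩ := exists_gluedCycle_walk k hk
    exact exists_cyclic_walk hw (hlast.trans h0.symm)
  obtain ⟨x, hx⟩ := hwalk m hm
  obtain ⟨y, hy⟩ := hwalk n hn
  exact toroidalGrid_colorable_of_pattern hm hn sixColorPattern (by decide) (by decide)
    (by decide) hx hy

end TorusColoring

end SimpleGraph

theorem theorem1 (m n : ℕ) (hm : 3 ≤ m) (hn : 3 ≤ n) :
    ((m ≡ 0 [MOD 5] ∧ n ≡ 0 [MOD 5]) →
      (SimpleGraph.toroidalGrid m n).incidenceChromaticNumber = 5) ∧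
    (¬ (m ≡ 0 [MOD 5] ∧ n ≡ 0 [MOD 5]) →
      (SimpleGraph.toroidalGrid m n).incidenceChromaticNumber = 6) := by
  have : NeZero m := ⟨by omega⟩
  have : NeZero n := ⟨by omega⟩
  rw [Nat.modEq_zero_iff_dvd, Nat.modEq_zero_iff_dvd]
  constructor
  · rintro ⟨h5m, h5n⟩
    exact (SimpleGraph.chromaticNumber_eq_iff_colorable_not_colorable (n := 4)).2
      ⟨SimpleGraph.toroidalGrid_colorable_five hm hn h5m h5n,
        SimpleGraph.toroidalGrid_not_colorable_four hm hn⟩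
  · intro h
    exact (SimpleGraph.chromaticNumber_eq_iff_colorable_not_colorable (n := 5)).2
      ⟨SimpleGraph.toroidalGrid_colorable_six hm hn,
        fun h5 => h (SimpleGraph.five_dvd_of_colorable_five hm hn h5)⟩
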